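/- Let $R$ be a commutative ring, let $F$ be an affine smooth $R$-group scheme of finite type with coordinate Hopf algebra $R[F]$, and let $S$ be an $F$-algebra, that is, a commutative $R$-algebra with a coaction $\omega\colon S\to S\otimes_R R[F]$ which is an $R$-algebra homomorphism and makes $S$ an $R[F]$-comodule. For a commutative ring $B$ let $Q(B)$ denote its total ring of fractions, the localization of $B$ at the set of its nonzerodivisors. Since $R[F]$ is flat over $R$, the map $\omega$ is flat and induces $\omega'\colon Q(S)\to Q(S\otimes_R R[F])$, and for every $R$-submodule $M$ of $Q(S)$ we regard $M\otimes_R R[F]\subset Q(S)\otimes_R R[F]\subset Q(S\otimes_R R[F])$. The $F$-total ring of fractions $Q_F(S)\subset Q(S)$ is the sum of all $R$-submodules $M$ of $Q(S)$ such that $\omega'(M)\subset M\otimes_R R[F]$; it is an $R$-subalgebra of $Q(S)$. Assume that $S$ is a Noetherian reduced Nagata ring (Nagata: for every prime ideal $P$ of $S$ and every finite field extension $L$ of the field of fractions of $S/P$, the integral closure of $S/P$ in $L$ is a finite $S/P$-module). Then $Q_F(S)$ is a finite direct product of Krull domains. Here a Krull domain is an integral domain which is the intersection of a family of discrete valuation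 rings of its field of fractions such that every nonzero element of that field has nonzero valuation for only finitely many members of the family (in particular, a field is a Krull domain). -/

import Mathlib

open scoped TensorProduct nonZeroDivisors

universe u v w

noncomputable section

/-- An action of the affine group scheme `F = Spec H` (`H = R[F]` a commutative Hopf algebra
over `R`) on the commutative `R`-algebra `S`, i.e. an `F`-algebra structure on `S`: a coaction
`S → S ⊗ R[F]` that is an `R`-algebra map, coassociative and counital. -/
structure AffineGroupAction (R : Type u) (H : Type v) (S : Type w)
    [CommRing R] [CommRing H] [HopfAlgebra R H] [CommRing S] [Algebra R S] where
  coaction : S →ₐ[R] S ⊗[R] H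
  coassoc :
    ((Algebra.TensorProduct.assoc R R R S H H).toAlgHom.comp
      (Algebra.TensorProduct.map coaction (AlgHom.id R H))).comp coaction =
    (Algebra.TensorProduct.map (AlgHom.id R S) (Bialgebra.comulAlgHom R H)).comp coaction
  counit :
    ((Algebra.TensorProduct.rid R R S).toAlgHom.comp
      (Algebra.TensorProduct.map (AlgHom.id R S) (Bialgebra.counitAlgHom R H))).comp coaction =
    AlgHom.id R S

namespace AffineGroupAction

section Flatness

variable {R : Type u} {H : Type v} {S : Type w}
    [CommRing R] [CommRing H] [HopfAlgebra R H] [CommRing S] [Algebra R S]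

/-- The map `s ⊗ h ↦ ∑ s₀ ⊗ m (s₁ ⊗ h)` of `S ⊗ H`, for an algebra map `m : H ⊗ H → H`. -/
def twist (ω : AffineGroupAction R H S) (m : H ⊗[R] H →ₐ[R] H) : S ⊗[R] H →ₐ[R] S ⊗[R] H :=
  (Algebra.TensorProduct.map (AlgHom.id R S) m).comp
    ((Algebra.TensorProduct.assoc R R R S H H).toAlgHom.comp
      (Algebra.TensorProduct.map ω.coaction (AlgHom.id R H)))

/-- `a ⊗ b ↦ a b`. -/
def mulHom (R : Type u) (H : Type v) [CommRing R] [CommRing H] [HopfAlgebra R H] :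
    H ⊗[R] H →ₐ[R] H :=
  Algebra.TensorProduct.lift (AlgHom.id R H) (AlgHom.id R H) (fun _ _ => Commute.all _ _)

/-- `a ⊗ b ↦ 𝒮(a) b`, with `𝒮` the antipode. -/
def antipodeMulHom (R : Type u) (H : Type v) [CommRing R] [CommRing H] [HopfAlgebra R H] :
    H ⊗[R] H →ₐ[R] H :=
  Algebra.TensorProduct.lift (HopfAlgebra.antipodeAlgHom R H) (AlgHom.id R H)
    (fun _ _ => Commute.all _ _)

theorem twist_coaction (ω : AffineGroupAction R H S) (m : H ⊗[R] H →ₐ[R] H) (s : S) :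
    ω.twist m (ω.coaction s) =
      Algebra.TensorProduct.map (AlgHom.id R S) (m.comp (Bialgebra.comulAlgHom R H))
        (ω.coaction s) := by
  have h := DFunLike.congr_fun ω.coassoc s
  simp only [AlgHom.comp_apply] at h
  simp only [twist, AlgHom.comp_apply]
  rw [h, ← AlgHom.comp_apply, ← Algebra.TensorProduct.map_comp]
  simp

theorem map_unit_counit_coaction (ω : AffineGroupAction R H S) (s : S) :
    Algebra.TensorProduct.map (AlgHom.id R S)
        ((Algebra.ofId R H).comp (Bialgebra.counitAlgHom R H)) (ω.coaction s) = s ⊗ₜ 1 := by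
  have h := DFunLike.congr_fun ω.counit s
  have key : (Algebra.TensorProduct.map (AlgHom.id R S)
        ((Algebra.ofId R H).comp (Bialgebra.counitAlgHom R H))) =
      (Algebra.TensorProduct.includeLeft : S →ₐ[R] S ⊗[R] H).comp
      ((Algebra.TensorProduct.rid R R S).toAlgHom.comp
      (Algebra.TensorProduct.map (AlgHom.id R S) (Bialgebra.counitAlgHom R H))) := by
    ext x
    · simp
    · simp [Algebra.algebraMap_eq_smul_one, Algebra.ofId_apply]
  rw [key, AlgHom.comp_apply, ← AlgHom.comp_apply _ ω.coaction, h]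
  simp

theorem antipodeMulHom_comp_comul :
    (antipodeMulHom R H).comp (Bialgebra.comulAlgHom R H) =
      (Algebra.ofId R H).comp (Bialgebra.counitAlgHom R H) := by
  have key : (antipodeMulHom R H).toLinearMap =
      LinearMap.mul' R H ∘ₗ (HopfAlgebra.antipode R).rTensor H := by
    ext a b
    simp [antipodeMulHom, HopfAlgebra.antipodeAlgHom]
  ext x
  have h := HopfAlgebra.mul_antipode_rTensor_comul_apply (R := R) x
  have h2 := DFunLike.congr_fun key (Coalgebra.comul (R := R) x)
  exact h2.trans h

theorem mulHom_map_antipode_comp_comul :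
    ((mulHom R H).comp
      (Algebra.TensorProduct.map (AlgHom.id R H) (HopfAlgebra.antipodeAlgHom R H))).comp
        (Bialgebra.comulAlgHom R H) =
      (Algebra.ofId R H).comp (Bialgebra.counitAlgHom R H) := by
  have key : ((mulHom R H).comp
      (Algebra.TensorProduct.map (AlgHom.id R H)
        (HopfAlgebra.antipodeAlgHom R H))).toLinearMap =
      LinearMap.mul' R H ∘ₗ (HopfAlgebra.antipode R).lTensor H := by
    ext a b
    simp [mulHom, HopfAlgebra.antipodeAlgHom]
  ext x
  have h := HopfAlgebra.mul_antipode_lTensor_comul_apply (R := R) x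
  have h2 := DFunLike.congr_fun key (Coalgebra.comul (R := R) x)
  exact h2.trans h

theorem twist_antipode_coaction (ω : AffineGroupAction R H S) (s : S) :
    ω.twist (antipodeMulHom R H) (ω.coaction s) = s ⊗ₜ 1 := by
  rw [twist_coaction, antipodeMulHom_comp_comul, map_unit_counit_coaction]

theorem twist_mul_twist_antipode (ω : AffineGroupAction R H S) (y : S ⊗[R] H) :
    ω.twist (mulHom R H) (ω.twist (antipodeMulHom R H) y) = y := by
  have e1 : ∀ z : S ⊗[R] H,
      (Algebra.TensorProduct.map (AlgHom.id R S) (antipodeMulHom R H))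
        ((Algebra.TensorProduct.assoc R R R S H H) (z ⊗ₜ 1)) =
      Algebra.TensorProduct.map (AlgHom.id R S) (HopfAlgebra.antipodeAlgHom R H) z := by
    intro z
    induction z with
    | zero => simp
    | add a b ha hb => simp only [TensorProduct.add_tmul, map_add, ha, hb]
    | tmul a b => simp [antipodeMulHom]
  have e2 : (ω.twist (mulHom R H)).comp
      (Algebra.TensorProduct.map (AlgHom.id R S) (HopfAlgebra.antipodeAlgHom R H)) =
      ω.twist ((mulHom R H).comp
        (Algebra.TensorProduct.map (AlgHom.id R H) (HopfAlgebra.antipodeAlgHom R H))) := by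
    have e3 : ∀ (z : S ⊗[R] H) (h : H),
        (Algebra.TensorProduct.map (AlgHom.id R S) (mulHom R H))
          ((Algebra.TensorProduct.assoc R R R S H H)
            (z ⊗ₜ (HopfAlgebra.antipodeAlgHom R H h))) =
        (Algebra.TensorProduct.map (AlgHom.id R S) ((mulHom R H).comp
          (Algebra.TensorProduct.map (AlgHom.id R H) (HopfAlgebra.antipodeAlgHom R H))))
          ((Algebra.TensorProduct.assoc R R R S H H) (z ⊗ₜ h)) := by
      intro z h
      induction z with
      | zero => simp
      | add a b ha hb => simp only [TensorProduct.add_tmul, map_add, ha, hb]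
      | tmul a b => simp
    refine Algebra.TensorProduct.ext' fun s h => ?_
    simpa [twist] using e3 (ω.coaction s) h
  have hs : ∀ s : S, ω.twist (mulHom R H) (ω.twist (antipodeMulHom R H) (s ⊗ₜ 1)) = s ⊗ₜ 1 := by
    intro s
    have : ω.twist (antipodeMulHom R H) (s ⊗ₜ 1) =
        Algebra.TensorProduct.map (AlgHom.id R S) (HopfAlgebra.antipodeAlgHom R H)
          (ω.coaction s) := by
      simpa [twist] using e1 (ω.coaction s)
    rw [this, ← AlgHom.comp_apply, e2, twist_coaction, mulHom_map_antipode_comp_comul,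
      map_unit_counit_coaction]
  have hh : ∀ h : H, ω.twist (mulHom R H) (ω.twist (antipodeMulHom R H) (1 ⊗ₜ h)) = 1 ⊗ₜ h := by
    intro h
    simp [twist, mulHom, antipodeMulHom, Algebra.TensorProduct.one_def]
  induction y with
  | zero => simp
  | add a b ha hb => simp only [map_add, ha, hb]
  | tmul s h =>
    have : (s ⊗ₜ[R] h : S ⊗[R] H) = s ⊗ₜ 1 * 1 ⊗ₜ h := by simp
    rw [this, map_mul, map_mul, hs, hh]

theorem includeLeft_mem_nonZeroDivisors [Module.Flat R H] {b : S} (hb : b ∈ S⁰) :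
    (Algebra.TensorProduct.includeLeft : S →ₐ[R] S ⊗[R] H) b ∈ (S ⊗[R] H)⁰ := by
  have hreg : IsSMulRegular (S ⊗[R] H) b := Module.Flat.isSMulRegular_of_nonZeroDivisors hb
  rw [mem_nonZeroDivisors_iff_right]
  intro y hy
  apply hreg
  simp only [smul_zero]
  rw [Algebra.smul_def, mul_comm]
  exact hy

/-- The coaction of a flat affine group scheme preserves nonzerodivisors. -/
theorem coaction_mem_nonZeroDivisors [Module.Flat R H] (ω : AffineGroupAction R H S)
    {b : S} (hb : b ∈ S⁰) : ω.coaction b ∈ (S ⊗[R] H)⁰ := by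
  rw [mem_nonZeroDivisors_iff_right]
  intro y hy
  have h1 : ω.twist (antipodeMulHom R H) y * (b ⊗ₜ 1) = 0 := by
    rw [← twist_antipode_coaction ω b, ← map_mul, hy, map_zero]
  have h2 : ω.twist (antipodeMulHom R H) y = 0 :=
    (mem_nonZeroDivisors_iff_right.1 (includeLeft_mem_nonZeroDivisors (R := R) (H := H) hb)) _ h1
  rw [← twist_mul_twist_antipode ω y, h2, map_zero]

end Flatness

/-- The map `Q(A) → Q(B)` of total rings of fractions induced by an algebra map `A → B` that
sends nonzerodivisors to nonzerodivisors. -/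
def fractionMap {R : Type u} {A : Type v} {B : Type w} [CommRing R] [CommRing A] [CommRing B]
    [Algebra R A] [Algebra R B] (f : A →ₐ[R] B) (hf : ∀ b ∈ A⁰, f b ∈ B⁰) :
    FractionRing A →ₐ[R] FractionRing B :=
  IsLocalization.liftAlgHom (M := A⁰)
    (f := (IsScalarTower.toAlgHom R B (FractionRing B)).comp f)
    (fun y => IsLocalization.map_units (FractionRing B) (⟨f y, hf y y.2⟩ : B⁰))

section FractionRing

variable {R : Type u} {H : Type v} {S : Type w}
    [CommRing R] [CommRing H] [HopfAlgebra R H] [CommRing S] [Algebra R S] [Module.Flat R H]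

/-- The map `ω' : Q(S) → Q(S ⊗ R[F])` induced by the coaction `ω`. -/
def fractionCoaction (ω : AffineGroupAction R H S) :
    FractionRing S →ₐ[R] FractionRing (S ⊗[R] H) :=
  fractionMap ω.coaction fun _ hb => ω.coaction_mem_nonZeroDivisors hb

/-- The canonical map `Q(S) ⊗ R[F] → Q(S ⊗ R[F])` (injective, since `R[F]` is flat). -/
def tensorToFraction (R : Type u) (H : Type v) (S : Type w)
    [CommRing R] [CommRing H] [HopfAlgebra R H] [CommRing S] [Algebra R S] [Module.Flat R H] :
    FractionRing S ⊗[R] H →ₐ[R] FractionRing (S ⊗[R] H) :=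
  Algebra.TensorProduct.lift
    (fractionMap (Algebra.TensorProduct.includeLeft : S →ₐ[R] S ⊗[R] H)
      fun _ hb => includeLeft_mem_nonZeroDivisors hb)
    ((IsScalarTower.toAlgHom R (S ⊗[R] H) (FractionRing (S ⊗[R] H))).comp
      Algebra.TensorProduct.includeRight)
    (fun _ _ => Commute.all _ _)

/-- `M ⊗ R[F]`, for an `R`-submodule `M` of `Q(S)`, as an `R`-submodule of `Q(S ⊗ R[F])`:
the image of `M ⊗ R[F] → Q(S) ⊗ R[F] → Q(S ⊗ R[F])`. -/
def tensorImage (H : Type v) [CommRing H] [HopfAlgebra R H] [Module.Flat R H]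
    (M : Submodule R (FractionRing S)) :
    Submodule R (FractionRing (S ⊗[R] H)) :=
  (LinearMap.range (M.subtype.rTensor H)).map (tensorToFraction R H S).toLinearMap

/-- The set `Ω` of the `R`-submodules `M` of `Q(S)` with `ω'(M) ⊆ M ⊗ R[F]`. -/
def stableSubmodules (ω : AffineGroupAction R H S) : Set (Submodule R (FractionRing S)) :=
  {M | M.map ω.fractionCoaction.toLinearMap ≤ tensorImage H M}

theorem tensorImage_mono {M N : Submodule R (FractionRing S)} (h : M ≤ N) :
    tensorImage H M ≤ tensorImage H N := by
  refine Submodule.map_mono ?_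
  rintro _ ⟨y, rfl⟩
  refine ⟨(Submodule.inclusion h).rTensor H y, ?_⟩
  rw [← LinearMap.comp_apply, ← LinearMap.rTensor_comp]
  rfl

theorem tmul_mem_tensorImage {M : Submodule R (FractionRing S)} {m : FractionRing S}
    (hm : m ∈ M) (h : H) : tensorToFraction R H S (m ⊗ₜ h) ∈ tensorImage H M :=
  ⟨m ⊗ₜ h, ⟨(⟨m, hm⟩ : M) ⊗ₜ h, by simp⟩, rfl⟩

theorem tensorImage_induction {M : Submodule R (FractionRing S)}
    {P : Submodule R (FractionRing (S ⊗[R] H))}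
    (hP : ∀ m ∈ M, ∀ h : H, tensorToFraction R H S (m ⊗ₜ h) ∈ P) : tensorImage H M ≤ P := by
  rintro _ ⟨_, ⟨y, rfl⟩, rfl⟩
  induction y with
  | zero => simp
  | add a b ha hb => simpa only [map_add] using P.add_mem ha hb
  | tmul m h => simpa using hP m m.2 h

theorem tensorImage_mul (M N : Submodule R (FractionRing S)) :
    tensorImage H M * tensorImage H N ≤ tensorImage H (M * N) := by
  rw [Submodule.mul_le]
  intro x hx y hy
  have h1 : tensorImage H M ≤
      (tensorImage H (M * N)).comap (LinearMap.mulRight R y) := by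
    refine tensorImage_induction fun m hm h => ?_
    have h2 : tensorImage H N ≤ (tensorImage H (M * N)).comap
        (LinearMap.mulLeft R (tensorToFraction R H S (m ⊗ₜ h))) := by
      refine tensorImage_induction fun n hn k => ?_
      rw [Submodule.mem_comap, LinearMap.mulLeft_apply, ← map_mul,
        Algebra.TensorProduct.tmul_mul_tmul]
      exact tmul_mem_tensorImage (Submodule.mul_mem_mul hm hn) _
    exact h2 hy
  exact h1 hx

theorem sSup_mem_stableSubmodules (ω : AffineGroupAction R H S) :
    sSup ω.stableSubmodules ∈ ω.stableSubmodules := by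
  change Submodule.map _ _ ≤ _
  rw [Submodule.map_le_iff_le_comap]
  refine sSup_le fun M hM => ?_
  rw [← Submodule.map_le_iff_le_comap]
  exact le_trans hM (tensorImage_mono (le_sSup hM))

theorem mul_mem_stableSubmodules (ω : AffineGroupAction R H S)
    {M N : Submodule R (FractionRing S)}
    (hM : M ∈ ω.stableSubmodules) (hN : N ∈ ω.stableSubmodules) :
    M * N ∈ ω.stableSubmodules := by
  change Submodule.map _ _ ≤ _
  rw [Submodule.map_mul]
  exact le_trans (mul_le_mul' hM hN) (tensorImage_mul M N)

theorem one_mem_stableSubmodules (ω : AffineGroupAction R H S) :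
    (1 : Submodule R (FractionRing S)) ∈ ω.stableSubmodules := by
  change Submodule.map _ _ ≤ _
  rw [Submodule.map_one, Submodule.one_le]
  have h := tmul_mem_tensorImage (H := H) (S := S) (R := R)
    (Submodule.one_le.1 le_rfl : (1 : FractionRing S) ∈ (1 : Submodule R (FractionRing S))) 1
  rwa [← Algebra.TensorProduct.one_def, map_one] at h

/-- The `F`-total ring of fractions `Q_F(S) = ∑_{M ∈ Ω} M`, as an `R`-subalgebra of `Q(S)`. -/
def equivariantFractionRing (ω : AffineGroupAction R H S) : Subalgebra R (FractionRing S) :=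
  (sSup ω.stableSubmodules).toSubalgebra
    (le_sSup ω.one_mem_stableSubmodules (Submodule.one_le.1 le_rfl))
    (fun _ _ hx hy =>
      le_sSup (ω.mul_mem_stableSubmodules ω.sSup_mem_stableSubmodules ω.sSup_mem_stableSubmodules)
        (Submodule.mul_mem_mul hx hy))

end FractionRing

end AffineGroupAction

/-- A Nagata ring: a Noetherian ring `A` such that for every prime `P` and every finite field
extension `L` of the field of fractions of `A ⧸ P`, the integral closure of `A ⧸ P` in `L` is a
finite `A ⧸ P`-module. -/
structure IsNagataRing (A : Type u) [CommRing A] : Prop where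
  isNoetherianRing : IsNoetherianRing A
  finite_integralClosure : ∀ (P : Ideal A) [P.IsPrime] (L : Type u) [Field L]
    [Algebra (A ⧸ P) L] [Algebra (FractionRing (A ⧸ P)) L]
    [IsScalarTower (A ⧸ P) (FractionRing (A ⧸ P)) L] [Module.Finite (FractionRing (A ⧸ P)) L],
    Module.Finite (A ⧸ P) (integralClosure (A ⧸ P) L)

/-- A Krull domain: an integral domain `B` that is the intersection, in its field of fractions
`K`, of a family of discrete valuation rings of `K` such that every nonzero element of `K` has
nonzero valuation for only finitely many members of the family. (Fields are included.) -/
def IsKrullDomain (B : Type u) [CommRing B] : Prop :=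
  ∃ _ : IsDomain B, ∃ 𝓥 : Set (ValuationSubring (FractionRing B)),
    (∀ V ∈ 𝓥, IsDiscreteValuationRing V) ∧
    (∀ x : FractionRing B, x ∈ (algebraMap B (FractionRing B)).range ↔ ∀ V ∈ 𝓥, x ∈ V) ∧
    ∀ x : FractionRing B, x ≠ 0 → {V ∈ 𝓥 | V.valuation x ≠ 1}.Finite

end

/-! Write `C` for Q(S), `H` for R[F] and ω' for the extension of the coaction to fractions. By
flatness of `H` and coassociativity, the set of all x in `C` with ω'(x) ∈ `C ⊗ H` is itself stable,
so it is the largest stable submodule and equals Q_F(S) (`mem_equivariantFractionRing_iff`). Thus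
Q_F(S) is the preimage of `C ⊗ H` under ω', and it suffices to describe `C ⊗ H` by valuations.

Since S is reduced and Noetherian, `C` is a finite product of fields. Hence `C ⊗ H`, being smooth
over `C`, is Noetherian and normal: locally it is étale over a polynomial ring over a field, and
étale base change commutes with integral closure. A Noetherian normal ring is cut out of its total
ring of fractions, here Q(S ⊗ H), by a locally finite family of discrete valuations
(`exists_valuation_of_isIntegrallyClosed_atPrime`).

These valuations pull back along ω' to a locally finite family on `C` cutting out Q_F(S). The
support of a valuation on `C` is prime, hence maximal, so each valuation lives on a single field
factor. Therefore Q_F(S) splits along the factors, and each piece is an intersection of discrete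
valuation rings (`exists_equiv_pi_isKrullDomain`). -/

open scoped WithZero

/-! ### Krull domains from locally finite families of valuations -/

section Krull

/-- A family of `ℤᵐ⁰`-valued valuations of a ring such that every unit has value `1` at all but
finitely many members. -/
def Valuation.LocallyFinite {ι Q : Type*} [CommRing Q] (v : ι → Valuation Q ℤᵐ⁰) : Prop :=
  ∀ x : Q, IsUnit x → {i | v i x ≠ 1}.Finite

/-- The value group is a nontrivial subgroup of the infinite cyclic group of units of `ℤᵐ⁰`. -/
theorem Valuation.isDiscreteValuationRing_of_exists_ne_one {K : Type*} [Field K]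
    (v : Valuation K ℤᵐ⁰) {x : K} (hx : x ≠ 0) (hvx : v x ≠ 1) :
    IsDiscreteValuationRing v.valuationSubring := by
  have : Nontrivial (MonoidWithZeroHom.valueGroup (.ofClass v)) := by
    rw [Subgroup.nontrivial_iff_exists_ne_one]
    refine ⟨Units.mk0 (v x) (by simpa using hx), MonoidWithZeroHom.mem_valueGroup _ ⟨x, rfl⟩, ?_⟩
    intro h
    exact hvx (by simpa using congrArg Units.val h)
  infer_instance

/-- The intersection of a locally finite family of discrete valuation rings of a field is a
Krull domain. -/
theorem isKrullDomain_of_locallyFinite {ι B E : Type*} [CommRing B] [Field E]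
    (f : B →+* E) (hf : Function.Injective f) (v : ι → Valuation E ℤᵐ⁰)
    (hv : Valuation.LocallyFinite v) (hB : ∀ x, x ∈ f.range ↔ ∀ i, v i x ≤ 1) :
    IsKrullDomain B := by
  have hdom : IsDomain B := hf.isDomain f
  let g : FractionRing B →+* E := IsFractionRing.lift hf
  have hg : ∀ b, g (algebraMap B _ b) = f b := IsFractionRing.lift_algebraMap hf
  let u : ι → Valuation (FractionRing B) ℤᵐ⁰ := fun i => (v i).comap g
  -- `E` may be larger than the fraction field of `B`, so some valuations may become trivial on it.
  -- They impose no condition and are discarded, as their valuation ring is a field.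
  refine ⟨hdom, {V | ∃ i x, x ≠ 0 ∧ u i x ≠ 1 ∧ V = (u i).valuationSubring}, ?_, ?_, ?_⟩
  · rintro _ ⟨i, x, hx, hux, rfl⟩
    exact (u i).isDiscreteValuationRing_of_exists_ne_one hx hux
  · intro x
    have h1 : x ∈ (algebraMap B (FractionRing B)).range ↔ ∀ i, u i x ≤ 1 := by
      rw [show (∀ i, u i x ≤ 1) ↔ ∀ i, v i (g x) ≤ 1 from Iff.rfl, ← hB]
      constructor
      · rintro ⟨b, rfl⟩
        exact ⟨b, (hg b).symm⟩
      · rintro ⟨b, hb⟩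
        exact ⟨b, g.injective ((hg b).trans hb)⟩
    rw [h1]
    constructor
    · rintro h _ ⟨i, -, -, -, rfl⟩
      exact h i
    · intro h i
      by_cases hx : x = 0
      · simp [hx]
      by_cases hux : u i x = 1
      · exact hux.le
      · exact h _ ⟨i, x, hx, hux, rfl⟩
  · intro x hx
    refine ((hv (g x) (by simpa using hx)).image fun i => (u i).valuationSubring).subset ?_
    rintro _ ⟨⟨i, -, -, -, rfl⟩, hVx⟩
    refine ⟨i, fun h => hVx ?_, rfl⟩
    exact ((Valuation.isEquiv_iff_val_eq_one.1
      (Valuation.isEquiv_valuation_valuationSubring (u i))).1 h)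

/-! ### Valuations on a finite product of fields -/

section Artinian

theorem isUnit_of_forall_mk_ne_zero {C : Type*} [CommRing C] {x : C}
    (h : ∀ m : MaximalSpectrum C, Ideal.Quotient.mk m.asIdeal x ≠ 0) : IsUnit x := by
  by_contra hx
  obtain ⟨m, hm, hxm⟩ := exists_max_ideal_of_mem_nonunits hx
  exact h ⟨m, hm⟩ (Ideal.Quotient.eq_zero_iff_mem.2 hxm)

/-- The support of `v` is a prime of an Artinian ring, hence maximal, so `v` lives on one factor. If
that factor is `m`, multiplying by `δ` does not change the value; otherwise `δ` lies in the support
and the value is 0. -/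
theorem Valuation.mul_le_one_of_idempotent {C : Type*} [CommRing C] [IsArtinianRing C]
    (v : Valuation C ℤᵐ⁰) {m : MaximalSpectrum C} {δ : C}
    (h1 : Ideal.Quotient.mk m.asIdeal δ = 1)
    (h0 : ∀ n : MaximalSpectrum C, n ≠ m → δ ∈ n.asIdeal) {x : C}
    (hx : m.asIdeal ≤ v.supp → v x ≤ 1) : v (δ * x) ≤ 1 := by
  have hmax : v.supp.IsMaximal := inferInstance
  by_cases h : m.asIdeal ≤ v.supp
  · have : v.onQuot h (Ideal.Quotient.mk _ (δ * x)) = v (δ * x) := rfl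
    rw [← this, map_mul, h1, one_mul]
    exact hx h
  · have := h0 ⟨v.supp, hmax⟩ (fun h' => h (by rw [← h']))
    rw [Valuation.mem_supp_iff] at this
    simp [this]

variable {C : Type w} [CommRing C] [IsArtinianRing C] [IsReduced C]

theorem IsArtinianRing.exists_mk_eq (y : ∀ m : MaximalSpectrum C, C ⧸ m.asIdeal) :
    ∃ x : C, ∀ m, Ideal.Quotient.mk m.asIdeal x = y m :=
  ⟨(IsArtinianRing.equivPi C).symm y, fun m =>
    congrFun ((IsArtinianRing.equivPi C).apply_symm_apply y) m⟩

theorem IsArtinianRing.eq_of_mk_eq {x y : C}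
    (h : ∀ m : MaximalSpectrum C, Ideal.Quotient.mk m.asIdeal x = Ideal.Quotient.mk m.asIdeal y) :
    x = y :=
  (IsArtinianRing.equivPi C).injective (funext h)

theorem IsArtinianRing.exists_idempotent (m : MaximalSpectrum C) :
    ∃ δ : C, Ideal.Quotient.mk m.asIdeal δ = 1 ∧ ∀ n : MaximalSpectrum C, n ≠ m → δ ∈ n.asIdeal := by
  classical
  obtain ⟨δ, hδ⟩ := IsArtinianRing.exists_mk_eq
    (Pi.single m 1 : ∀ n : MaximalSpectrum C, C ⧸ n.asIdeal)
  refine ⟨δ, by rw [hδ, Pi.single_eq_same], fun n hn => ?_⟩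
  rw [← Ideal.Quotient.eq_zero_iff_mem, hδ, Pi.single_eq_of_ne hn]

/-- A subring of a reduced Artinian ring that is closed under the projections to the factors is
the product of its images in the residue fields. -/
theorem Subring.nonempty_equiv_pi_map_mk (B : Subring C)
    (hB : ∀ (m : MaximalSpectrum C) (δ : C), Ideal.Quotient.mk m.asIdeal δ = 1 →
      (∀ n : MaximalSpectrum C, n ≠ m → δ ∈ n.asIdeal) → ∀ b ∈ B, δ * b ∈ B) :
    Nonempty (B ≃+* ∀ m : MaximalSpectrum C, B.map (Ideal.Quotient.mk m.asIdeal)) := by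
  have : Fintype (MaximalSpectrum C) := Fintype.ofFinite _
  let ψ : ∀ m : MaximalSpectrum C, B →+* B.map (Ideal.Quotient.mk m.asIdeal) := fun m =>
    ((Ideal.Quotient.mk m.asIdeal).comp B.subtype).codRestrict _ fun x => ⟨x, x.2, rfl⟩
  refine ⟨RingEquiv.ofBijective (RingHom.pi ψ) ⟨fun x y hxy => ?_, fun y => ?_⟩⟩
  · exact Subtype.ext (IsArtinianRing.eq_of_mk_eq fun m =>
      congrArg Subtype.val (congrFun hxy m))
  · choose b hb hby using fun m => (y m).2
    choose δ h1 h0 using IsArtinianRing.exists_idempotent (C := C)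
    refine ⟨⟨∑ m, δ m * b m, sum_mem fun m _ => hB m _ (h1 m) (h0 m) _ (hb m)⟩,
      funext fun m => Subtype.ext ?_⟩
    change Ideal.Quotient.mk m.asIdeal (∑ m, δ m * b m) = y m
    rw [map_sum, Finset.sum_eq_single m, map_mul, h1, one_mul, hby]
    · intro n _ hn
      rw [map_mul, Ideal.Quotient.eq_zero_iff_mem.2 (h0 n m hn.symm), zero_mul]
    · simp

/-- The image of `B` in the factor at `m` is cut out by exactly those valuations that live on this
factor. -/
theorem isKrullDomain_map_mk {ι : Type*} (v : ι → Valuation C ℤᵐ⁰)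
    (hv : Valuation.LocallyFinite v) (B : Subring C) (hB : ∀ x, x ∈ B ↔ ∀ i, v i x ≤ 1)
    (m : MaximalSpectrum C) : IsKrullDomain (B.map (Ideal.Quotient.mk m.asIdeal)) := by
  classical
  let _ : Field (C ⧸ m.asIdeal) := Ideal.Quotient.field _
  refine isKrullDomain_of_locallyFinite (Subring.subtype _) Subtype.val_injective
    (ι := {i // m.asIdeal ≤ (v i).supp}) (fun i => (v i.1).onQuot i.2) ?_ ?_
  · intro y hy
    -- Local finiteness concerns units of `C`, so `y` is lifted with component 1 in all other
    -- factors.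
    obtain ⟨x, hx⟩ := IsArtinianRing.exists_mk_eq
      (Function.update (1 : ∀ n : MaximalSpectrum C, C ⧸ n.asIdeal) m y)
    have hxu : IsUnit x := by
      refine isUnit_of_forall_mk_ne_zero fun n => ?_
      rw [hx]
      by_cases hn : n = m
      · subst hn
        rw [Function.update_self]
        exact hy.ne_zero
      · rw [Function.update_of_ne hn]
        exact one_ne_zero
    have hxy : Ideal.Quotient.mk m.asIdeal x = y := by rw [hx, Function.update_self]
    refine Set.Finite.of_finite_image ((hv x hxu).subset ?_) Subtype.val_injective.injOn
    rintro _ ⟨⟨i, hi⟩, h, rfl⟩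
    rw [← hxy] at h
    exact h
  · intro y
    obtain ⟨x, rfl⟩ := Ideal.Quotient.mk_surjective y
    rw [Subring.range_subtype]
    constructor
    · rintro ⟨b, hb, hbx⟩ i
      rw [← hbx]
      exact (hB b).1 hb i
    · intro h
      -- Multiplying by the idempotent keeps the image at `m` and makes the valuations on the other
      -- factors vanish.
      obtain ⟨δ, h1, h0⟩ := IsArtinianRing.exists_idempotent m
      refine ⟨δ * x, (hB _).2 fun i => (v i).mul_le_one_of_idempotent h1 h0 fun hi => h ⟨i, hi⟩, ?_⟩
      rw [map_mul, h1, one_mul]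

/-- A subring of a reduced Artinian ring cut out by a locally finite family of discrete
valuations is a finite product of Krull domains. -/
theorem exists_equiv_pi_isKrullDomain {ι : Type*} (v : ι → Valuation C ℤᵐ⁰)
    (hv : Valuation.LocallyFinite v) (B : Subring C) (hB : ∀ x, x ∈ B ↔ ∀ i, v i x ≤ 1) :
    ∃ (n : ℕ) (D : Fin n → Type w) (_ : ∀ i, CommRing (D i)),
      (∀ i, IsKrullDomain (D i)) ∧ Nonempty (B ≃+* ∀ i, D i) := by
  obtain ⟨φ⟩ := B.nonempty_equiv_pi_map_mk fun m δ h1 h0 b hb =>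
    (hB _).2 fun i => (v i).mul_le_one_of_idempotent h1 h0 fun _ => (hB b).1 hb i
  let e := Finite.equivFin (MaximalSpectrum C)
  exact ⟨_, fun i => B.map (Ideal.Quotient.mk (e.symm i).asIdeal), fun i => inferInstance,
    fun i => isKrullDomain_map_mk v hv B hB _, ⟨φ.trans
      (RingEquiv.piCongrLeft' (fun m => B.map (Ideal.Quotient.mk m.asIdeal)) e)⟩⟩

end Artinian

/-- The total ring of fractions of a reduced Noetherian ring is Artinian. -/
theorem isArtinianRing_of_isFractionRing_self (C : Type*) [CommRing C] [IsNoetherianRing C]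
    [IsReduced C] [IsFractionRing C C] : IsArtinianRing C := by
  rw [isArtinianRing_iff_isNoetherianRing_krullDimLE_zero, Ring.krullDimLE_zero_iff]
  refine ⟨inferInstance, fun P hP => ?_⟩
  obtain ⟨m, hm, hPm⟩ := Ideal.exists_le_maximal P hP.ne_top
  obtain rfl | hne := eq_or_ne P m
  · exact hm
  exfalso
  obtain ⟨y, hym, hyP⟩ := SetLike.exists_of_lt (lt_of_le_of_ne hPm hne)
  -- In a Noetherian total ring of fractions a maximal ideal is an annihilator, `m = ann x`. If `P`
  -- is strictly smaller, choose `y` in `m` outside `P`: then `y * x = 0` forces `x ∈ P ≤ m`, so `x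
  -- * x = 0` and `x = 0` by reducedness.
  have hass := Ideal.IsMaximal.mem_associatedPrimes_of_isFractionRing C m
  rw [AssociatedPrimes.mem_iff, isAssociatedPrime_iff] at hass
  obtain ⟨-, x, rfl⟩ := hass
  have hann : ∀ z, z ∈ (⊥ : Submodule C C).colon {x} ↔ z * x = 0 := fun z => by
    simp [Submodule.mem_colon_singleton]
  have hxP : x ∈ P := (hP.mem_or_mem (show y * x ∈ P by
    rw [(hann y).1 hym]; exact P.zero_mem)).resolve_left hyP
  have hx0 : x = 0 := by
    have := (hann x).1 (hPm hxP)
    exact IsReduced.eq_zero x ⟨2, by rw [pow_two]; exact this⟩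
  exact hm.ne_top (by rw [Ideal.eq_top_iff_one, hann, hx0, mul_zero])

end Krull

/-! ### Noetherian normal rings as intersections of discrete valuation rings -/

section Normal

open IsLocalRing in
/-- A Noetherian integrally closed local domain whose maximal ideal is associated to a nonzero
principal ideal is a discrete valuation ring. -/
theorem isDiscreteValuationRing_of_mem_maximalIdeal_iff_dvd {D : Type*} [CommRing D] [IsDomain D]
    [IsNoetherianRing D] [IsLocalRing D] [IsIntegrallyClosed D] {b c : D} (hb : b ≠ 0)
    (h : ∀ x, x ∈ maximalIdeal D ↔ b ∣ x * c) : IsDiscreteValuationRing D := by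
  let K := FractionRing D
  have hbm : b ∈ maximalIdeal D := (h b).2 (dvd_mul_right _ _)
  have hfield : ¬ IsField D := by
    rw [isField_iff_maximalIdeal_eq]
    exact fun hbot => hb (by rwa [hbot, Ideal.mem_bot] at hbm)
  have hbK : algebraMap D K b ≠ 0 := by simpa using hb
  -- The fraction `c / b` multiplies the maximal ideal into `D`. If the product stayed inside the
  -- maximal ideal, `c / b` would be integral, hence in `D`, making `1` an element of the maximal
  -- ideal. So some `t` has `t * c / b` a unit, and this `t` generates the maximal ideal.
  obtain ⟨t, ht, u, hu, htu⟩ : ∃ t ∈ maximalIdeal D, ∃ u, IsUnit u ∧ t * c = b * u := by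
    by_contra! hcon
    have hint : IsIntegral D (algebraMap D K c / algebraMap D K b) := by
      refine isIntegral_of_smul_mem_submodule
        (Submodule.map (Algebra.linearMap D K) (maximalIdeal D)) ?_ ?_ _ ?_
      · rw [Submodule.ne_bot_iff]
        exact ⟨_, ⟨b, hbm, rfl⟩, hbK⟩
      · exact Submodule.FG.map _ (IsNoetherian.noetherian _)
      · rintro _ ⟨x, hx, rfl⟩
        obtain ⟨z, hz⟩ := (h x).1 hx
        refine ⟨z, ?_, ?_⟩
        · by_contra hzm
          exact hcon x hx z (by simpa using hzm) hz
        · simp only [Algebra.linearMap_apply, smul_eq_mul]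
          rw [div_mul_eq_mul_div, eq_div_iff hbK, ← map_mul, ← map_mul, mul_comm c, hz, mul_comm]
    obtain ⟨y, hy⟩ := IsIntegrallyClosed.algebraMap_eq_of_integral hint
    rw [eq_div_iff hbK, ← map_mul] at hy
    have hy' := IsFractionRing.injective D K hy
    exact (Ideal.ne_top_iff_one _).1 (maximalIdeal.isMaximal D).ne_top
      ((h 1).2 ⟨y, by rw [one_mul, ← hy', mul_comm]⟩)
  have hprin : maximalIdeal D = Ideal.span {t} := by
    refine le_antisymm ?_ ((Ideal.span_singleton_le_iff_mem _).2 ht)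
    intro x hx
    obtain ⟨z, hz⟩ := (h x).1 hx
    obtain ⟨w, hw⟩ := hu.exists_right_inv
    refine Ideal.mem_span_singleton'.2 ⟨z * w, ?_⟩
    have h1 : b * (x * u) = b * (z * t) := by
      linear_combination t * hz - x * htu
    have h2 := mul_left_cancel₀ hb h1
    linear_combination (-w) * h2 + x * hw
  have hprin' : (maximalIdeal D).IsPrincipal := ⟨t, hprin⟩
  exact ((IsDiscreteValuationRing.TFAE D hfield).out 4 0).1 hprin'

variable {A : Type u} {L : Type*} [CommRing A] [CommRing L] [Algebra A L] [IsFractionRing A L]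

/-- The map from the total ring of fractions of `A` to the field of fractions of the local
domain `A_p`. -/
noncomputable def fractionRingToAtPrime (A L : Type*) [CommRing A] [CommRing L] [Algebra A L]
    [IsFractionRing A L] (p : Ideal A) [p.IsPrime] [IsDomain (Localization.AtPrime p)] :
    L →+* FractionRing (Localization.AtPrime p) :=
  IsLocalization.lift (M := A⁰)
    (g := (algebraMap (Localization.AtPrime p) (FractionRing (Localization.AtPrime p))).comp
      (algebraMap A (Localization.AtPrime p))) fun y => by
    have h := IsLocalization.map_nonZeroDivisors_le p.primeCompl (Localization.AtPrime p)
      ⟨y, y.2, rfl⟩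
    exact (IsLocalization.map_units _ (⟨_, h⟩ : (Localization.AtPrime p)⁰))

theorem fractionRingToAtPrime_algebraMap (p : Ideal A) [p.IsPrime]
    [IsDomain (Localization.AtPrime p)] (a : A) :
    fractionRingToAtPrime A L p (algebraMap A L a) =
      algebraMap _ _ (algebraMap A (Localization.AtPrime p) a) := by
  simp [fractionRingToAtPrime]

/-- The valuation of the total ring of fractions of `A` at a prime `p` such that `A_p` is a
discrete valuation ring. -/
noncomputable def valuationAtPrime (A L : Type*) [CommRing A] [CommRing L] [Algebra A L]
    [IsFractionRing A L] (p : Ideal A) [p.IsPrime] [IsDomain (Localization.AtPrime p)]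
    [IsDiscreteValuationRing (Localization.AtPrime p)] : Valuation L ℤᵐ⁰ :=
  ((IsDiscreteValuationRing.maximalIdeal (Localization.AtPrime p)).valuation
    (FractionRing (Localization.AtPrime p))).comap (fractionRingToAtPrime A L p)

section

variable (p : Ideal A) [p.IsPrime] [IsDomain (Localization.AtPrime p)]
    [IsDiscreteValuationRing (Localization.AtPrime p)]

theorem valuationAtPrime_algebraMap_le_one (a : A) :
    valuationAtPrime A L p (algebraMap A L a) ≤ 1 := by
  rw [valuationAtPrime, Valuation.comap_apply, fractionRingToAtPrime_algebraMap]
  exact IsDedekindDomain.HeightOneSpectrum.valuation_le_one _ _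

theorem valuationAtPrime_algebraMap_eq_one_iff (a : A) :
    valuationAtPrime A L p (algebraMap A L a) = 1 ↔ a ∉ p := by
  rw [valuationAtPrime, Valuation.comap_apply, fractionRingToAtPrime_algebraMap,
    IsDedekindDomain.HeightOneSpectrum.valuation_eq_one_iff_notMem]
  exact (IsLocalization.AtPrime.to_map_mem_maximal_iff (Localization.AtPrime p) p a).not

/-- Value at most 1 means that the image of `a / b` lies in the local ring at `p`; clearing
denominators gives `s`. -/
theorem exists_mul_eq_of_valuationAtPrime_le_one {x : L} {a b : A}
    (hx : x * algebraMap A L b = algebraMap A L a) (h : valuationAtPrime A L p x ≤ 1) :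
    ∃ s ∉ p, b ∣ s * a := by
  obtain ⟨y, hy⟩ := IsDiscreteValuationRing.exists_lift_of_le_one h
  have hxa := congrArg (fractionRingToAtPrime A L p) hx
  rw [map_mul, fractionRingToAtPrime_algebraMap, fractionRingToAtPrime_algebraMap, ← hy,
    ← map_mul] at hxa
  have hya := IsFractionRing.injective (Localization.AtPrime p) _ hxa
  obtain ⟨⟨z, s⟩, hz⟩ := IsLocalization.surj p.primeCompl y
  have h1 : algebraMap A (Localization.AtPrime p) (s * a) = algebraMap A _ (z * b) := by
    rw [map_mul, map_mul, ← hz, ← hya]; ring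
  obtain ⟨r, hr⟩ := (IsLocalization.eq_iff_exists p.primeCompl (Localization.AtPrime p)).1 h1
  refine ⟨r * s, p.primeCompl.mul_mem r.2 s.2, r * z, ?_⟩
  linear_combination hr

/-- A prime between `(a)` and `p` localizes to a nonzero prime of a discrete valuation ring, hence
to the maximal ideal. This gives local finiteness, as `(a)` has finitely many minimal primes in a
Noetherian ring. -/
theorem mem_minimalPrimes_of_isDiscreteValuationRing {a : A} (ha : a ∈ A⁰) (hap : a ∈ p) :
    p ∈ (Ideal.span {a}).minimalPrimes := by
  refine ⟨⟨inferInstance, by simpa using hap⟩, ?_⟩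
  rintro q ⟨hq, haq⟩ hqp
  have hdisj : Disjoint (p.primeCompl : Set A) q :=
    Set.disjoint_left.2 fun x hx hxq => hx (hqp hxq)
  have hprime := IsLocalization.isPrime_of_isPrime_disjoint p.primeCompl
    (Localization.AtPrime p) q hq hdisj
  have ha0 : algebraMap A (Localization.AtPrime p) a ≠ 0 :=
    nonZeroDivisors.ne_zero (IsLocalization.map_nonZeroDivisors_le p.primeCompl
      (Localization.AtPrime p) ⟨a, ha, rfl⟩)
  have haq' : algebraMap A (Localization.AtPrime p) a ∈
      q.map (algebraMap A (Localization.AtPrime p)) :=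
    Ideal.mem_map_of_mem _ (haq (Ideal.mem_span_singleton_self a))
  have hmax := hprime.isMaximal (fun h => ha0 (by rwa [h, Ideal.mem_bot] at haq'))
  rw [← IsLocalization.under_map_of_isPrime_disjoint p.primeCompl (Localization.AtPrime p) hq hdisj,
    IsLocalRing.eq_maximalIdeal hmax, IsLocalization.AtPrime.under_maximalIdeal _ p]

end

/-- A Noetherian normal ring is cut out, in its total ring of fractions, by a locally finite
family of discrete valuations. -/
theorem exists_valuation_of_isIntegrallyClosed_atPrime [IsNoetherianRing A]
    (hA : ∀ (p : Ideal A) [p.IsPrime], IsDomain (Localization.AtPrime p) ∧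
      IsIntegrallyClosed (Localization.AtPrime p)) :
    ∃ (ι : Type u) (v : ι → Valuation L ℤᵐ⁰), Valuation.LocallyFinite v ∧
      ∀ x, x ∈ (algebraMap A L).range ↔ ∀ i, v i x ≤ 1 := by
  have hdom := fun p : PrimeSpectrum A => (hA p.asIdeal).1
  let ι := {p : PrimeSpectrum A // IsDiscreteValuationRing (Localization.AtPrime p.asIdeal)}
  have hdvr : ∀ i : ι, IsDiscreteValuationRing (Localization.AtPrime i.1.asIdeal) := fun i => i.2
  refine ⟨ι, fun i => valuationAtPrime A L i.1.asIdeal, ?_, ?_⟩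
  · intro x hx
    have hfin : ∀ a ∈ A⁰, {i : ι | a ∈ i.1.asIdeal}.Finite := by
      intro a ha
      refine Set.Finite.of_finite_image (f := fun i : ι => i.1.asIdeal)
        ((Ideal.finite_minimalPrimes_of_isNoetherianRing A (Ideal.span {a})).subset ?_)
        fun i _ j _ h => Subtype.ext (PrimeSpectrum.ext h)
      rintro _ ⟨i, hi, rfl⟩
      exact mem_minimalPrimes_of_isDiscreteValuationRing i.1.asIdeal ha hi
    obtain ⟨⟨a, b⟩, hab⟩ := IsLocalization.surj A⁰ x
    have ha : a ∈ A⁰ := by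
      have h1 : IsUnit (algebraMap A L a) := by
        rw [← hab]; exact hx.mul (IsLocalization.map_units L b)
      rw [mem_nonZeroDivisors_iff_right]
      intro y hy
      refine IsFractionRing.injective A L ?_
      rw [map_zero, ← h1.mul_left_eq_zero, ← map_mul, hy, map_zero]
    refine ((hfin a ha).union (hfin b b.2)).subset fun i hi => ?_
    by_contra hcon
    simp only [Set.mem_union, Set.mem_ofPred_eq, not_or] at hcon
    have h2 := congrArg (valuationAtPrime A L i.1.asIdeal) hab
    rw [map_mul, (valuationAtPrime_algebraMap_eq_one_iff _ _).2 hcon.1,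
      (valuationAtPrime_algebraMap_eq_one_iff _ _).2 hcon.2, mul_one] at h2
    exact hi h2
  · intro x
    constructor
    · rintro ⟨a, rfl⟩ i
      exact valuationAtPrime_algebraMap_le_one _ a
    · intro hx
      obtain ⟨⟨a, b⟩, hab⟩ := IsLocalization.surj A⁰ x
      suffices h : (b : A) ∣ a by
        obtain ⟨c, rfl⟩ := h
        refine ⟨c, (IsLocalization.map_units L b).mul_right_cancel ?_⟩
        rw [hab, map_mul, mul_comm]
      by_contra hba
      have hmk : ∀ y : A, Ideal.Quotient.mk (Ideal.span {(b : A)}) y = 0 ↔ (b : A) ∣ y := fun y => by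
        rw [Ideal.Quotient.eq_zero_iff_mem, Ideal.mem_span_singleton]
      -- If `b` does not divide `a`, the annihilator of the class of `a` modulo `b` lies in an
      -- associated prime `p`. The local ring at `p` is a discrete valuation ring, so the bound on
      -- `x` there yields `s ∉ p` with `b ∣ s * a`, a contradiction.
      obtain ⟨p, hp, hap⟩ := exists_le_isAssociatedPrime_of_isNoetherianRing A
        (Ideal.Quotient.mk (Ideal.span {(b : A)}) a) (by rwa [ne_eq, hmk])
      rw [isAssociatedPrime_iff] at hp
      obtain ⟨hprime, c, hc⟩ := hp
      obtain ⟨c, rfl⟩ := Ideal.Quotient.mk_surjective c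
      have hcolon : ∀ d y : A, y ∈ (⊥ : Submodule A (A ⧸ Ideal.span {(b : A)})).colon
          {Ideal.Quotient.mk (Ideal.span {(b : A)}) d} ↔ (b : A) ∣ y * d := fun d y => by
        rw [Submodule.mem_colon_singleton, Submodule.mem_bot, ← hmk, map_mul]; rfl
      have hpc : ∀ y, y ∈ p ↔ (b : A) ∣ y * c := fun y => by rw [hc, hcolon]
      have hdomp := (hA p).1
      have hicp := (hA p).2
      have hNp : IsNoetherianRing (Localization.AtPrime p) := inferInstance
      have hD : IsDiscreteValuationRing (Localization.AtPrime p) := by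
        refine isDiscreteValuationRing_of_mem_maximalIdeal_iff_dvd
          (b := algebraMap A _ (b : A)) (c := algebraMap A _ c) ?_ ?_
        · exact nonZeroDivisors.ne_zero (IsLocalization.map_nonZeroDivisors_le p.primeCompl
            (Localization.AtPrime p) ⟨b, b.2, rfl⟩)
        · intro z
          obtain ⟨⟨y, s⟩, hy⟩ := IsLocalization.surj p.primeCompl z
          have hs := IsLocalization.map_units (Localization.AtPrime p) s
          have hzy : z ∈ IsLocalRing.maximalIdeal (Localization.AtPrime p) ↔ y ∈ p := by
            rw [← IsLocalization.AtPrime.to_map_mem_maximal_iff (Localization.AtPrime p) p y, ← hy,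
              Ideal.mul_unit_mem_iff_mem _ hs]
          have hdvd : algebraMap A (Localization.AtPrime p) b ∣ z * algebraMap A _ c ↔
              algebraMap A (Localization.AtPrime p) b ∣ algebraMap A _ (y * c) := by
            rw [map_mul, ← hy, mul_right_comm, hs.dvd_mul_right]
          rw [hzy, hdvd]
          constructor
          · intro hyp
            exact map_dvd _ ((hpc y).1 hyp)
          · rintro ⟨w, hw⟩
            obtain ⟨⟨e, t⟩, he⟩ := IsLocalization.surj p.primeCompl w
            have h1 : algebraMap A (Localization.AtPrime p) (t * (y * c)) =
                algebraMap A _ (b * e) := by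
              rw [map_mul, hw, map_mul, ← he]; ring
            obtain ⟨r, hr⟩ :=
              (IsLocalization.eq_iff_exists p.primeCompl (Localization.AtPrime p)).1 h1
            have h2 : (r * t : A) * y ∈ p := (hpc _).2 ⟨r * e, by linear_combination hr⟩
            exact (hprime.mem_or_mem h2).resolve_left (p.primeCompl.mul_mem r.2 t.2)
      obtain ⟨s, hs, hsa⟩ := exists_mul_eq_of_valuationAtPrime_le_one p hab
        (hx ⟨⟨p, hprime⟩, hD⟩)
      exact hs (hap ((hcolon a s).2 hsa))

end Normal

/-! ### Normality of smooth algebras -/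

section Smooth

/-- A local ring that is integrally closed in a reduced Artinian ring obtained from it by inverting
some elements is an integrally closed domain. -/
theorem IsLocalRing.isDomain_and_isIntegrallyClosed {D T : Type*} [CommRing D] [IsLocalRing D]
    [CommRing T] [Algebra D T] [IsArtinianRing T] [IsReduced T]
    (hinj : Function.Injective (algebraMap D T)) (M : Submonoid D) [IsLocalization M T]
    (hint : ∀ x : T, IsIntegral D x → x ∈ (algebraMap D T).range) :
    IsDomain D ∧ IsIntegrallyClosed D := by
  have hT : Nontrivial T := hinj.nontrivial
  -- Idempotents are integral, being roots of `X ^ 2 - X`, so they come from `D`, and a local ring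
  -- has only trivial ones.
  have hidem : ∀ e : T, e * e = e → e = 0 ∨ e = 1 := by
    intro e he
    obtain ⟨d, rfl⟩ := hint e ⟨Polynomial.X ^ 2 - Polynomial.X,
      Polynomial.monic_X_pow_sub (by simp), by simp [pow_two, he]⟩
    have hd : d * d = d := hinj (by rw [map_mul, he])
    have hd' : d * (1 - d) = 0 := by linear_combination -hd
    rcases IsLocalRing.isUnit_or_isUnit_one_sub_self d with h | h
    · right
      have : 1 - d = 0 := h.mul_right_eq_zero.1 hd'
      rw [← sub_eq_zero.1 this, map_one]
    · left
      rw [h.mul_left_eq_zero.1 hd', map_zero]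
  have hfield : IsField T := by
    refine ⟨exists_pair_ne T, mul_comm, fun {x} hx => ?_⟩
    classical
    -- The witness is the componentwise inverse, with `0⁻¹ = 0`; then `x * y` is idempotent.
    obtain ⟨y, hy⟩ : ∃ y : T, x = x * x * y := by
      let e := IsArtinianRing.equivPi T
      let _ : ∀ m : MaximalSpectrum T, Field (T ⧸ m.asIdeal) := fun m => Ideal.Quotient.field _
      refine ⟨e.symm fun m => (e x m)⁻¹, e.injective (funext fun m => ?_)⟩
      rw [map_mul, map_mul, e.apply_symm_apply, Pi.mul_apply, Pi.mul_apply]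
      by_cases h : e x m = 0
      · simp [h]
      · field_simp
    refine ⟨y, (hidem (x * y) ?_).resolve_left fun h => hx ?_⟩
    · linear_combination (-y) * hy
    · rw [hy, mul_assoc, h, mul_zero]
  let _ := hfield.toField
  have hdom : IsDomain D := hinj.isDomain (algebraMap D T)
  have : FaithfulSMul D T := (faithfulSMul_iff_algebraMap_injective D T).2 hinj
  have hfrac : IsFractionRing D T := IsFractionRing.of_field D T fun z => by
    obtain ⟨⟨a, s⟩, h⟩ := IsLocalization.surj M z
    exact ⟨a, s, (eq_div_iff (IsLocalization.map_units T s).ne_zero).2 h⟩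
  exact ⟨hdom, (isIntegrallyClosed_iff T).2 fun hx => hint _ hx⟩

/-- Integral closure commutes with smooth base change and with localization, so `D` is integrally
closed in `D ⊗ Frac P`. That ring is finite and unramified over a field, hence reduced Artinian; it
is a localization of `D`, which embeds by flatness. -/
theorem isDomain_and_isIntegrallyClosed_atPrime_of_etale {P G : Type*} [CommRing P] [IsDomain P]
    [IsIntegrallyClosed P] [CommRing G] [Algebra P G] [Algebra.Etale P G] (p : Ideal G)
    [p.IsPrime] :
    IsDomain (Localization.AtPrime p) ∧ IsIntegrallyClosed (Localization.AtPrime p) := by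
  let D := Localization.AtPrime p
  let E := FractionRing P
  have : Algebra.FormallyEtale G D := .of_isLocalization p.primeCompl
  have : Algebra.FormallyEtale P D := .comp P G D
  have : Algebra.EssFiniteType G D := .of_isLocalization D p.primeCompl
  have : Algebra.EssFiniteType P D := .comp P G D
  have : Module.Flat P D := inferInstance
  have hbij : Function.Bijective (TensorProduct.toIntegralClosure P D E) :=
    TensorProduct.toIntegralClosure_bijective_of_tower (S := G)
      TensorProduct.toIntegralClosure_bijective_of_smooth
      (TensorProduct.toIntegralClosure_bijective_of_isLocalization p.primeCompl)
  let e : E ⊗[P] D ≃ₐ[P] D ⊗[P] E := Algebra.TensorProduct.comm P E D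
  have hfin : Module.Finite E (E ⊗[P] D) := Algebra.FormallyUnramified.finite_of_free _ _
  have hred : IsReduced (E ⊗[P] D) := Algebra.FormallyUnramified.isReduced_of_field E (E ⊗[P] D)
  have hart : IsArtinianRing (E ⊗[P] D) := isArtinian_of_tower E inferInstance
  have hred' : IsReduced (D ⊗[P] E) := isReduced_of_injective e.symm e.symm.injective
  have hart' : IsArtinianRing (D ⊗[P] E) := e.toRingEquiv.isArtinianRing
  have hloc : IsLocalization (Algebra.algebraMapSubmonoid D P⁰) (D ⊗[P] E) :=
    inferInstance
  refine IsLocalRing.isDomain_and_isIntegrallyClosed (T := D ⊗[P] E) ?_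
    (Algebra.algebraMapSubmonoid D P⁰) ?_
  · exact Algebra.TensorProduct.includeLeft_injective (R := P) (S := P) (A := D) (B := E) (IsFractionRing.injective P E)
  · intro x hx
    obtain ⟨y, hy⟩ := hbij.2 ⟨x, hx⟩
    have hy' := congrArg Subtype.val hy
    simp only at hy'
    rw [← hy']
    clear hy hy'
    induction y with
    | zero => exact ⟨0, by simp⟩
    | add a b ha hb => rw [map_add]; exact add_mem ha hb
    | tmul d z =>
      -- Since `P` is its own integral closure in `E`, the second factor can be moved into `D`.
      obtain ⟨c, hc⟩ := IsIntegrallyClosed.algebraMap_eq_of_integral z.2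
      refine ⟨c • d, ?_⟩
      simp [TensorProduct.toIntegralClosure, ← hc, Algebra.algebraMap_eq_smul_one,
        Algebra.TensorProduct.one_def, TensorProduct.smul_tmul']

theorem isDomain_and_isIntegrallyClosed_atPrime_of_isLocalization {A B : Type*} [CommRing A]
    [CommRing B] [Algebra A B] (M : Submonoid A) [IsLocalization M B]
    (hB : ∀ (q : Ideal B) [q.IsPrime],
      IsDomain (Localization.AtPrime q) ∧ IsIntegrallyClosed (Localization.AtPrime q))
    (p : Ideal A) [hp : p.IsPrime] (hM : Disjoint (M : Set A) p) :
    IsDomain (Localization.AtPrime p) ∧ IsIntegrallyClosed (Localization.AtPrime p) := by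
  have hprime := IsLocalization.isPrime_of_isPrime_disjoint M B p hp hM
  have hloc := IsLocalization.isLocalization_isLocalization_atPrime_isLocalization M
    (Localization.AtPrime (p.map (algebraMap A B))) (p.map (algebraMap A B))
  have hcomap : (p.map (algebraMap A B)).comap (algebraMap A B) = p :=
    IsLocalization.under_map_of_isPrime_disjoint M B hp hM
  simp only [hcomap] at hloc
  let e := IsLocalization.algEquiv p.primeCompl (Localization.AtPrime (p.map (algebraMap A B)))
    (Localization.AtPrime p)
  obtain ⟨h1, h2⟩ := hB (p.map (algebraMap A B))
  exact ⟨e.symm.toMulEquiv.isDomain _, IsIntegrallyClosed.of_equiv e.toRingEquiv⟩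

/-- Near each prime a smooth algebra is étale over a polynomial ring, which is an integrally closed
domain. -/
theorem isDomain_and_isIntegrallyClosed_atPrime_of_smooth_field {K A : Type*} [Field K]
    [CommRing A] [Algebra K A] [Algebra.Smooth K A] (p : Ideal A) [hp : p.IsPrime] :
    IsDomain (Localization.AtPrime p) ∧ IsIntegrallyClosed (Localization.AtPrime p) := by
  obtain ⟨f, hfp, n, _, _, _⟩ :=
    Algebra.IsSmoothAt.exists_isStandardEtale_mvPolynomial (R := K) (p := p)
  exact isDomain_and_isIntegrallyClosed_atPrime_of_isLocalization (.powers f)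
    (fun q _ => isDomain_and_isIntegrallyClosed_atPrime_of_etale
      (P := MvPolynomial (Fin n) K) (G := Localization.Away f) q) p
    ((Ideal.disjoint_powers_iff_notMem_of_isPrime _).mpr hfp)

/-- The local rings of a smooth algebra over a reduced Artinian ring are integrally closed
domains. -/
theorem isDomain_and_isIntegrallyClosed_atPrime_of_smooth {C A : Type*} [CommRing C]
    [IsArtinianRing C] [IsReduced C] [CommRing A] [Algebra C A] [Algebra.Smooth C A]
    (p : Ideal A) [hp : p.IsPrime] :
    IsDomain (Localization.AtPrime p) ∧ IsIntegrallyClosed (Localization.AtPrime p) := by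
  -- The localization of `C` at `q` is a field, and base change to it inverts only elements outside
  -- `p`, so the local ring at `p` is unchanged.
  let q := p.comap (algebraMap C A)
  let K := Localization.AtPrime q
  let _ : Field K := (IsArtinianRing.isField_of_isReduced_of_isLocalRing K).toField
  let _ : Algebra A (K ⊗[C] A) := Algebra.TensorProduct.rightAlgebra
  have hloc : IsLocalization (Algebra.algebraMapSubmonoid A q.primeCompl) (K ⊗[C] A) :=
    inferInstance
  refine isDomain_and_isIntegrallyClosed_atPrime_of_isLocalization
    (B := K ⊗[C] A) (Algebra.algebraMapSubmonoid A q.primeCompl)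
    (fun r _ => isDomain_and_isIntegrallyClosed_atPrime_of_smooth_field (K := K) r) p ?_
  rw [Set.disjoint_left]
  rintro _ ⟨x, hx, rfl⟩ hxp
  exact hx hxp

end Smooth

/-! ### Fractions of `S ⊗ H` and coassociativity of ω' -/

namespace AffineGroupAction

theorem fractionMap_algebraMap {R A B : Type*} [CommRing R] [CommRing A] [CommRing B]
    [Algebra R A] [Algebra R B] (f : A →ₐ[R] B) (hf : ∀ b ∈ A⁰, f b ∈ B⁰) (a : A) :
    fractionMap f hf (algebraMap A (FractionRing A) a) = algebraMap B (FractionRing B) (f a) := by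
  exact IsLocalization.lift_eq _ a

section

variable {R : Type u} {H : Type v} {S : Type w}
    [CommRing R] [CommRing H] [HopfAlgebra R H] [CommRing S] [Algebra R S]

/-- The canonical map `S ⊗ H → Q(S) ⊗ H`. -/
noncomputable def tensorFractionMap (R : Type u) (H : Type v) (S : Type w)
    [CommRing R] [CommRing H] [HopfAlgebra R H] [CommRing S] [Algebra R S] :
    S ⊗[R] H →ₐ[R] FractionRing S ⊗[R] H :=
  Algebra.TensorProduct.map (IsScalarTower.toAlgHom R S (FractionRing S)) (AlgHom.id R H)

theorem exists_mul_eq_tensorFractionMap (z : FractionRing S ⊗[R] H) :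
    ∃ b ∈ S⁰, ∃ y, z * tensorFractionMap R H S (b ⊗ₜ 1) = tensorFractionMap R H S y := by
  induction z with
  | zero => exact ⟨1, one_mem _, 0, by simp⟩
  | tmul x h =>
    obtain ⟨⟨a, b⟩, hab⟩ := IsLocalization.surj S⁰ x
    exact ⟨b, b.2, a ⊗ₜ h, by simp [tensorFractionMap, hab]⟩
  | add z₁ z₂ h₁ h₂ =>
    obtain ⟨b₁, hb₁, y₁, e₁⟩ := h₁
    obtain ⟨b₂, hb₂, y₂, e₂⟩ := h₂
    refine ⟨b₁ * b₂, mul_mem hb₁ hb₂, y₁ * (b₂ ⊗ₜ 1) + y₂ * (b₁ ⊗ₜ 1), ?_⟩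
    have : ((b₁ * b₂) ⊗ₜ[R] (1 : H) : S ⊗[R] H) = (b₁ ⊗ₜ 1) * (b₂ ⊗ₜ 1) := by simp
    rw [this, map_mul, map_add, map_mul, map_mul, ← e₁, ← e₂]
    ring

theorem isUnit_tensorFractionMap {b : S} (hb : b ∈ S⁰) :
    IsUnit (tensorFractionMap R H S (b ⊗ₜ 1)) := by
  have := (IsLocalization.map_units (FractionRing S) ⟨b, hb⟩).map
    (Algebra.TensorProduct.includeLeft : FractionRing S →ₐ[R] FractionRing S ⊗[R] H)
  simpa [tensorFractionMap] using this

/-- The base change `ω ⊗ H` of a coaction preserves nonzerodivisors. -/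
theorem map_coaction_mem_nonZeroDivisors [Module.Flat R H] (ω : AffineGroupAction R H S)
    {c : S ⊗[R] H} (hc : c ∈ (S ⊗[R] H)⁰) :
    Algebra.TensorProduct.map ω.coaction (AlgHom.id R H) c ∈ ((S ⊗[R] H) ⊗[R] H)⁰ := by
  -- The antipode twist `τ` has left inverse `τ'` and turns `ω ⊗ H` into `s ⊗ h ↦ (s ⊗ 1) ⊗ h`.
  -- Swapping the two copies of `H` by `σ` gives `c ⊗ 1`, a nonzerodivisor by flatness.
  let τ : (S ⊗[R] H) ⊗[R] H →ₐ[R] (S ⊗[R] H) ⊗[R] H :=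
    Algebra.TensorProduct.map (ω.twist (antipodeMulHom R H)) (AlgHom.id R H)
  let τ' : (S ⊗[R] H) ⊗[R] H →ₐ[R] (S ⊗[R] H) ⊗[R] H :=
    Algebra.TensorProduct.map (ω.twist (mulHom R H)) (AlgHom.id R H)
  let σ : (S ⊗[R] H) ⊗[R] H ≃ₐ[R] (S ⊗[R] H) ⊗[R] H :=
    ((Algebra.TensorProduct.assoc R R R S H H).trans
      (Algebra.TensorProduct.congr AlgEquiv.refl (Algebra.TensorProduct.comm R H H))).trans
        (Algebra.TensorProduct.assoc R R R S H H).symm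
  have hτ : ∀ y, τ' (τ y) = y := by
    have : τ'.comp τ = AlgHom.id R _ := by
      rw [← Algebra.TensorProduct.map_comp]
      have h1 : (ω.twist (mulHom R H)).comp (ω.twist (antipodeMulHom R H)) = AlgHom.id R _ :=
        AlgHom.ext ω.twist_mul_twist_antipode
      rw [h1, AlgHom.comp_id, Algebra.TensorProduct.map_id]
    exact DFunLike.congr_fun this
  have hτω : ∀ y : S ⊗[R] H, τ (Algebra.TensorProduct.map ω.coaction (AlgHom.id R H) y) =
      Algebra.TensorProduct.map (Algebra.TensorProduct.includeLeft : S →ₐ[R] S ⊗[R] H)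
        (AlgHom.id R H) y := by
    intro y
    rw [← AlgHom.comp_apply, ← Algebra.TensorProduct.map_comp]
    have h1 : (ω.twist (antipodeMulHom R H)).comp ω.coaction =
        Algebra.TensorProduct.includeLeft := AlgHom.ext ω.twist_antipode_coaction
    rw [h1, AlgHom.comp_id]
  have hσ : ∀ y : S ⊗[R] H,
      σ (Algebra.TensorProduct.map (Algebra.TensorProduct.includeLeft : S →ₐ[R] S ⊗[R] H)
        (AlgHom.id R H) y) =
        (Algebra.TensorProduct.includeLeft : S ⊗[R] H →ₐ[R] (S ⊗[R] H) ⊗[R] H) y := by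
    intro y
    induction y with
    | zero => simp
    | add a b ha hb => simp only [map_add, ha, hb]
    | tmul a b => simp [σ]
  rw [mem_nonZeroDivisors_iff_right]
  intro y hy
  have h1 : σ (τ y) * (Algebra.TensorProduct.includeLeft :
      S ⊗[R] H →ₐ[R] (S ⊗[R] H) ⊗[R] H) c = 0 := by
    rw [← hσ, ← hτω, ← map_mul, ← map_mul, hy, map_zero, map_zero]
  have h2 := mem_nonZeroDivisors_iff_right.1 (includeLeft_mem_nonZeroDivisors hc) _ h1
  rw [← hτ y, (map_eq_zero_iff σ σ.injective).1 h2, map_zero]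

variable [Module.Flat R H]

theorem tensorToFraction_tensorFractionMap (y : S ⊗[R] H) :
    tensorToFraction R H S (tensorFractionMap R H S y) =
      algebraMap (S ⊗[R] H) (FractionRing (S ⊗[R] H)) y := by
  induction y with
  | zero => simp
  | add a b ha hb => simp only [map_add, ha, hb]
  | tmul a b =>
    simp [tensorToFraction, tensorFractionMap, fractionMap_algebraMap, ← map_mul]

theorem tensorFractionMap_injective : Function.Injective (tensorFractionMap R H S) := by
  intro x y h
  apply IsFractionRing.injective (S ⊗[R] H) (FractionRing (S ⊗[R] H))
  rw [← tensorToFraction_tensorFractionMap, h, tensorToFraction_tensorFractionMap]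

/-- The canonical map `Q(S) ⊗ H → Q(S ⊗ H)` is injective. -/
theorem tensorToFraction_injective : Function.Injective (tensorToFraction R H S) := by
  rw [injective_iff_map_eq_zero]
  intro z hz
  obtain ⟨b, hb, y, hy⟩ := exists_mul_eq_tensorFractionMap z
  have h1 := congrArg (tensorToFraction R H S) hy
  rw [map_mul, hz, zero_mul, tensorToFraction_tensorFractionMap] at h1
  have h2 : y = 0 := IsFractionRing.injective (S ⊗[R] H) (FractionRing (S ⊗[R] H))
    (by rw [← h1, map_zero])
  rw [h2, map_zero] at hy
  exact (isUnit_tensorFractionMap hb).mul_left_eq_zero.1 hy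

/-- `Q(S ⊗ H)` is the total ring of fractions of `Q(S) ⊗ H`. -/
theorem isFractionRing_tensorToFraction :
    letI := (tensorToFraction R H S).toRingHom.toAlgebra
    IsFractionRing (FractionRing S ⊗[R] H) (FractionRing (S ⊗[R] H)) := by
  let _ := (tensorToFraction R H S).toRingHom.toAlgebra
  have halg : ∀ z, algebraMap (FractionRing S ⊗[R] H) (FractionRing (S ⊗[R] H)) z =
      tensorToFraction R H S z := fun _ => rfl
  refine ⟨⟨?_, ?_, ?_⟩⟩
  · rintro ⟨z, hz⟩
    obtain ⟨b, hb, y, hy⟩ := exists_mul_eq_tensorFractionMap z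
    have hy' : y ∈ (S ⊗[R] H)⁰ := by
      rw [mem_nonZeroDivisors_iff_right]
      intro x hx
      have h1 : tensorFractionMap R H S (x * b ⊗ₜ 1) * z = 0 := by
        rw [map_mul, mul_assoc, mul_comm _ z, hy, ← map_mul, hx, map_zero]
      have h2 := mem_nonZeroDivisors_iff_right.1 hz _ h1
      rw [map_mul] at h2
      exact tensorFractionMap_injective
        (by rw [(isUnit_tensorFractionMap hb).mul_left_eq_zero.1 h2, map_zero])
    have h3 : IsUnit (tensorToFraction R H S z * algebraMap _ _ (b ⊗ₜ[R] (1 : H))) := by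
      rw [← tensorToFraction_tensorFractionMap, ← map_mul, hy, tensorToFraction_tensorFractionMap]
      exact IsLocalization.map_units _ (⟨y, hy'⟩ : (S ⊗[R] H)⁰)
    exact isUnit_of_mul_isUnit_left h3
  · intro x
    obtain ⟨⟨y, t⟩, h⟩ := IsLocalization.surj (S ⊗[R] H)⁰ x
    refine ⟨⟨tensorFractionMap R H S y, tensorFractionMap R H S t, ?_⟩, ?_⟩
    · rw [mem_nonZeroDivisors_iff_right]
      intro z hz
      have h1 := congrArg (tensorToFraction R H S) hz
      rw [map_mul, tensorToFraction_tensorFractionMap, map_zero,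
        (IsLocalization.map_units _ t).mul_left_eq_zero] at h1
      exact tensorToFraction_injective (by rw [h1, map_zero])
    · simpa only [halg, tensorToFraction_tensorFractionMap] using h
  · intro x y h
    exact ⟨1, by rw [tensorToFraction_injective h]⟩

theorem fractionCoaction_algebraMap (ω : AffineGroupAction R H S) (s : S) :
    ω.fractionCoaction (algebraMap S (FractionRing S) s) = algebraMap _ _ (ω.coaction s) :=
  fractionMap_algebraMap _ _ _

/-- Coassociativity of `ω'`: if `ω'(x)` lies in `Q(S) ⊗ H`, then applying `ω'` to its first factor
is the same as applying the comultiplication to its second factor. -/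
theorem map_fractionCoaction_eq (ω : AffineGroupAction R H S) {x : FractionRing S}
    {z : FractionRing S ⊗[R] H} (hz : tensorToFraction R H S z = ω.fractionCoaction x) :
    Algebra.TensorProduct.map ω.fractionCoaction (AlgHom.id R H) z =
      Algebra.TensorProduct.map (tensorToFraction R H S) (AlgHom.id R H)
        ((Algebra.TensorProduct.assoc R R R (FractionRing S) H H).symm
          (Algebra.TensorProduct.map (AlgHom.id R _) (Bialgebra.comulAlgHom R H) z)) := by
  let Φ : FractionRing S ⊗[R] H →ₐ[R] FractionRing (S ⊗[R] H) ⊗[R] H :=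
    Algebra.TensorProduct.map ω.fractionCoaction (AlgHom.id R H)
  let Ψ : FractionRing S ⊗[R] H →ₐ[R] FractionRing (S ⊗[R] H) ⊗[R] H :=
    (Algebra.TensorProduct.map (tensorToFraction R H S) (AlgHom.id R H)).comp
      ((Algebra.TensorProduct.assoc R R R (FractionRing S) H H).symm.toAlgHom.comp
        (Algebra.TensorProduct.map (AlgHom.id R _) (Bialgebra.comulAlgHom R H)))
  change Φ z = Ψ z
  have hΦ : ∀ y : S ⊗[R] H, Φ (tensorFractionMap R H S y) = tensorFractionMap R H (S ⊗[R] H)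
      (Algebra.TensorProduct.map ω.coaction (AlgHom.id R H) y) := by
    intro y
    induction y with
    | zero => simp
    | add a b ha hb => simp only [map_add, ha, hb]
    | tmul a b => simp [Φ, tensorFractionMap, fractionCoaction_algebraMap]
  have hΨ : ∀ y : S ⊗[R] H, Ψ (tensorFractionMap R H S y) = tensorFractionMap R H (S ⊗[R] H)
      ((Algebra.TensorProduct.assoc R R R S H H).symm
        (Algebra.TensorProduct.map (AlgHom.id R _) (Bialgebra.comulAlgHom R H) y)) := by
    intro y
    induction y with
    | zero => simp
    | add a b ha hb => simp only [map_add, ha, hb]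
    | tmul a b =>
      have key : ∀ c : H ⊗[R] H,
          Algebra.TensorProduct.map (tensorToFraction R H S) (AlgHom.id R H)
            ((Algebra.TensorProduct.assoc R R R (FractionRing S) H H).symm
              (algebraMap S (FractionRing S) a ⊗ₜ c)) =
          tensorFractionMap R H (S ⊗[R] H)
            ((Algebra.TensorProduct.assoc R R R S H H).symm (a ⊗ₜ c)) := by
        intro c
        induction c with
        | zero => simp
        | add c d hc hd => simp only [TensorProduct.tmul_add, map_add, hc, hd]
        | tmul c d =>
          have := tensorToFraction_tensorFractionMap (R := R) (a ⊗ₜ[R] c)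
          simp only [tensorFractionMap, Algebra.TensorProduct.map_tmul] at this
          simp only [tensorFractionMap, Algebra.TensorProduct.assoc_symm_tmul,
            Algebra.TensorProduct.map_tmul, AlgHom.coe_id, id_eq]
          exact congrArg (· ⊗ₜ[R] d) this
      simpa [Ψ, tensorFractionMap] using key (Coalgebra.comul b)
  have hω : ∀ s, Φ (tensorFractionMap R H S (ω.coaction s)) =
      Ψ (tensorFractionMap R H S (ω.coaction s)) := by
    intro s
    rw [hΦ, hΨ]
    congr 1
    have h := DFunLike.congr_fun ω.coassoc s
    rw [← AlgHom.comp_apply, AlgEquiv.eq_symm_apply]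
    exact h
  -- With `x = a / b`, the element `z` is a quotient of `ω a` by `ω b`, where `Φ` and `Ψ` agree by
  -- coassociativity. The denominator `Φ (ω b)` becomes a unit in the total ring of fractions of `(S
  -- ⊗ H) ⊗ H`, so it cancels.
  obtain ⟨⟨a, b⟩, hab⟩ := IsLocalization.surj S⁰ x
  have hzb : z * tensorFractionMap R H S (ω.coaction b) =
      tensorFractionMap R H S (ω.coaction a) := by
    apply tensorToFraction_injective
    rw [map_mul, hz, tensorToFraction_tensorFractionMap, tensorToFraction_tensorFractionMap,
      ← fractionCoaction_algebraMap, ← fractionCoaction_algebraMap, ← map_mul, hab]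
  have heq : Φ z * Φ (tensorFractionMap R H S (ω.coaction b)) =
      Ψ z * Φ (tensorFractionMap R H S (ω.coaction b)) := by
    nth_rewrite 2 [hω]
    rw [← map_mul, ← map_mul, hzb, hω]
  apply tensorToFraction_injective
  have hu : IsUnit (tensorToFraction R H (S ⊗[R] H)
      (Φ (tensorFractionMap R H S (ω.coaction b)))) := by
    rw [hΦ, tensorToFraction_tensorFractionMap]
    exact IsLocalization.map_units _ (⟨_, ω.map_coaction_mem_nonZeroDivisors
      (ω.coaction_mem_nonZeroDivisors b.2)⟩ : ((S ⊗[R] H) ⊗[R] H)⁰)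
  exact hu.mul_right_cancel (by
    simpa only [map_mul] using congrArg (tensorToFraction R H (S ⊗[R] H)) heq)

/-! ### Q_F(S) as a preimage under ω' -/

/-- The submodule `{x | ω'(x) ∈ Q(S) ⊗ H}` of `Q(S)`. -/
noncomputable def largestStableSubmodule (ω : AffineGroupAction R H S) :
    Submodule R (FractionRing S) :=
  (LinearMap.range (tensorToFraction R H S).toLinearMap).comap ω.fractionCoaction.toLinearMap

theorem mem_largestStableSubmodule {ω : AffineGroupAction R H S} {x : FractionRing S} :
    x ∈ ω.largestStableSubmodule ↔ ω.fractionCoaction x ∈ (tensorToFraction R H S).range :=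
  Iff.rfl

/-- The submodule is the kernel of the map `g` from Q(S) to Q(S ⊗ H) modulo Q(S) ⊗ H, so by flatness
its tensor product with `H` is the kernel of `g ⊗ H`. Coassociativity rewrites `(ω' ⊗ 1) z` as the
image of `(1 ⊗ Δ) z`, which comes from (Q(S) ⊗ H) ⊗ H and so dies in the quotient. -/
theorem largestStableSubmodule_mem_stableSubmodules (ω : AffineGroupAction R H S) :
    ω.largestStableSubmodule ∈ ω.stableSubmodules := by
  rintro _ ⟨x, hx, rfl⟩
  obtain ⟨z, hz⟩ := hx
  refine ⟨z, ?_, hz⟩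
  let J := LinearMap.range (tensorToFraction R H S).toLinearMap
  let g : FractionRing S →ₗ[R] FractionRing (S ⊗[R] H) ⧸ J :=
    J.mkQ ∘ₗ ω.fractionCoaction.toLinearMap
  have hexact : Function.Exact ω.largestStableSubmodule.subtype g := by
    rw [LinearMap.exact_iff, Submodule.range_subtype, LinearMap.ker_comp, Submodule.ker_mkQ]
    rfl
  refine (Module.Flat.rTensor_exact H hexact z).1 ?_
  have h1 : g.rTensor H z = J.mkQ.rTensor H
      (Algebra.TensorProduct.map ω.fractionCoaction (AlgHom.id R H) z) := by
    rw [LinearMap.rTensor_comp]; rfl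
  rw [h1, ω.map_fractionCoaction_eq hz]
  have h2 : ∀ y : (FractionRing S ⊗[R] H) ⊗[R] H, J.mkQ.rTensor H
      (Algebra.TensorProduct.map (tensorToFraction R H S) (AlgHom.id R H) y) = 0 := by
    intro y
    induction y with
    | zero => simp
    | add a b ha hb => rw [map_add, map_add, ha, hb, add_zero]
    | tmul a b =>
      have : J.mkQ (tensorToFraction R H S a) = 0 := by
        rw [Submodule.mkQ_apply, Submodule.Quotient.mk_eq_zero]
        exact ⟨a, rfl⟩
      rw [Algebra.TensorProduct.map_tmul, LinearMap.rTensor_tmul, this, TensorProduct.zero_tmul]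
  exact h2 _

/-- `Q_F(S)` consists of the `x ∈ Q(S)` such that `ω'(x) ∈ Q(S) ⊗ R[F]`. -/
theorem mem_equivariantFractionRing_iff (ω : AffineGroupAction R H S) (x : FractionRing S) :
    x ∈ ω.equivariantFractionRing ↔
      ω.fractionCoaction x ∈ (tensorToFraction R H S).range := by
  rw [← mem_largestStableSubmodule]
  constructor
  · intro hx
    have h : sSup ω.stableSubmodules ≤ ω.largestStableSubmodule := by
      refine sSup_le fun M hM y hy => ?_
      obtain ⟨z, -, hz⟩ := hM ⟨y, hy, rfl⟩
      exact ⟨z, hz⟩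
    exact h hx
  · intro hx
    exact le_sSup ω.largestStableSubmodule_mem_stableSubmodules hx

end

end AffineGroupAction

/-! The local rings of `Q(S) ⊗ R[F]` are integrally closed domains since `R[F]` is smooth, so the
argument does not use the Nagata hypothesis. -/

theorem mainTheorem8 {R : Type u} {H : Type v} {S : Type w}
    [CommRing R] [CommRing H] [HopfAlgebra R H] [Algebra.Smooth R H]
    [CommRing S] [Algebra R S] [IsNoetherianRing S] [IsReduced S] (hS : IsNagataRing S)
    (ω : AffineGroupAction R H S) :
    ∃ (n : ℕ) (B : Fin n → Type w) (_ : ∀ i, CommRing (B i)),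
      (∀ i, IsKrullDomain (B i)) ∧
      Nonempty (ω.equivariantFractionRing ≃+* ∀ i, B i) := by
  let C := FractionRing S
  let A := C ⊗[R] H
  have : IsNoetherianRing C := IsLocalization.isNoetherianRing S⁰ C inferInstance
  have : IsArtinianRing C := isArtinianRing_of_isFractionRing_self C
  have : IsNoetherianRing A := Algebra.FiniteType.isNoetherianRing C A
  let _ : Algebra A (FractionRing (S ⊗[R] H)) :=
    (AffineGroupAction.tensorToFraction R H S).toRingHom.toAlgebra
  have : IsFractionRing A (FractionRing (S ⊗[R] H)) :=
    AffineGroupAction.isFractionRing_tensorToFraction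
  obtain ⟨ι, v, hv, hmem⟩ := exists_valuation_of_isIntegrallyClosed_atPrime
    (A := A) (L := FractionRing (S ⊗[R] H))
    fun p _ => isDomain_and_isIntegrallyClosed_atPrime_of_smooth (C := C) p
  -- Ring maps preserve units, so the pulled-back family on `C` remains locally finite.
  refine exists_equiv_pi_isKrullDomain (fun i => (v i).comap ω.fractionCoaction.toRingHom)
    (fun x hx => hv _ (hx.map ω.fractionCoaction)) ω.equivariantFractionRing.toSubring fun x => ?_
  exact (ω.mem_equivariantFractionRing_iff x).trans (hmem (ω.fractionCoaction x))
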